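/- Let $K$ be a field and let $E=(E^0,E^1,r,s)$ be an arbitrary directed graph. The Leavitt path algebra $L=L_K(E)$ is the free associative (not necessarily unital) $K$-algebra generated by $E^0\cup E^1\cup (E^1)^*$ subject to the relations $vv'=\delta_{v,v'}v$ for $v,v'\in E^0$; $s(e)e=er(e)=e$ and $r(e)e^*=e^*s(e)=e^*$ for $e\in E^1$; $e^*f=\delta_{e,f}r(e)$ for $e,f\in E^1$; and $v=\sum_{s(e)=v}ee^*$ for every vertex $v$ that emits at least one and only finitely many edges. It carries the standard involution $^\star$: the $K$-linear anti-automorphism with $v\mapsto v$, $e\mapsto e^*$, $e^*\mapsto e$. For a $K$-algebra $A$ with a $K$-linear involution $^\star$ put $\mathbf K_A=\{x\in A : x^\star=-x\}$, and let $[\mathbf K_A,\mathbf K_A]$ be the $K$-subspace spanned by all $ab-ba$ with $a,b\in\mathbf K_A$. The involution is of the first kind if $a^\star=a$ for all $a$ in the center of $A$. A ring (with or without unit) is simple if its multiplication is not identically zero and it has exactly two two-sided ideals, zero and the whole ring. A cycle in $E$ is a sequence of edges $e_1\cdots e_n$, $n\ge 1$, with $r(e_i)=s(e_{i+1})$ for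 $i<n$, $r(e_n)=s(e_1)$, and $s(e_1),\dots,s(e_n)$ pairwise distinct. **Proposition 3.9.** Let $K$ be a field. 1. If $E$ is a graph containing a cycle and $L=L_K(E)$ is simple, then the standard involution of $L$ is of the first kind and $\mathbf K_L\neq[\mathbf K_L,\mathbf K_L]$. 2. In particular, for every $n\ge 2$, let $R_n$ be the rose with $n$ petals (one vertex and $n$ loops). Then $L_K(R_n)$ is simple, its standard involution is of the first kind, and $\mathbf K_{L_K(R_n)}\neq[\mathbf K_{L_K(R_n)},\mathbf K_{L_K(R_n)}]$. 3. Consequently Herstein's question has a negative answer over every field $K$: it is not true that $\mathbf K_A=[\mathbf K_A,\mathbf K_A]$ for every simple $K$-algebra $A$ with a $K$-linear involution of the first kind. -/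

import Mathlib

universe u v w x

noncomputable section

/-- A directed graph `(E⁰, E¹, r, s)`: arbitrary types of vertices and edges (loops and multiple
edges allowed, no finiteness), with source and range maps. -/
structure DirectedGraph where
  /-- the vertices `E⁰` -/
  Vertex : Type v
  /-- the edges `E¹` -/
  Edge : Type w
  /-- the source map `s` -/
  s : Edge → Vertex
  /-- the range map `r` -/
  r : Edge → Vertex

namespace DirectedGraph

/-- A cycle: a nonempty sequence of edges `e₁ e₂ ⋯ eₙ` with `r(eᵢ) = s(eᵢ₊₁)` for `i < n`,
with `r(eₙ) = s(e₁)`, and whose sources `s(e₁), …, s(eₙ)` are pairwise distinct. -/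
def IsCycle (E : DirectedGraph.{v, w}) (c : List E.Edge) : Prop :=
  ∃ h : c ≠ [], c.IsChain (fun e f => E.r e = E.s f) ∧
    E.r (c.getLast h) = E.s (c.head h) ∧ (c.map E.s).Nodup

/-- The graph contains a cycle. -/
def HasCycle (E : DirectedGraph.{v, w}) : Prop := ∃ c : List E.Edge, E.IsCycle c

/-- The rose with `n` petals: one vertex and `n` loops. -/
abbrev rose (n : ℕ) : DirectedGraph.{0, 0} where
  Vertex := Unit
  Edge := Fin n
  s _ := ()
  r _ := ()

/-- The set `E⁰ ∪ E¹ ∪ (E¹)*` of generators. -/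
inductive Generator (E : DirectedGraph.{v, w}) : Type (max v w)
  | vertex (a : E.Vertex)
  | edge (e : E.Edge)
  | ghost (e : E.Edge)

/-- The involution of the set of generators: `v ↦ v`, `e ↦ e*`, `e* ↦ e`. -/
def Generator.conj {E : DirectedGraph.{v, w}} : Generator E → Generator E
  | vertex a => vertex a
  | edge e => ghost e
  | ghost e => edge e

end DirectedGraph

open DirectedGraph

/-- The free associative (non-unital) `K`-algebra on a set `X`: linear combinations of nonempty
words in `X`. -/
abbrev FreeAssoc (K : Type u) [Field K] (X : Type x) : Type (max u x) :=
  MonoidAlgebra K (FreeSemigroup X)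

/-- A free generator. -/
def FreeAssoc.of (K : Type u) [Field K] {X : Type x} (a : X) : FreeAssoc K X :=
  MonoidAlgebra.ofMagma K _ (FreeSemigroup.of a)

/-- The homomorphism of non-unital algebras determined by the images of the free generators. -/
def FreeAssoc.lift (K : Type u) [Field K] {X : Type x} {A : Type w} [NonUnitalRing A] [Module K A]
    [IsScalarTower K A A] [SMulCommClass K A A] (f : X → A) : FreeAssoc K X →ₙₐ[K] A :=
  MonoidAlgebra.liftMagma K (FreeSemigroup.lift f)

@[simp] lemma FreeAssoc.lift_of (K : Type u) [Field K] {X : Type x} {A : Type w} [NonUnitalRing A]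
    [Module K A] [IsScalarTower K A A] [SMulCommClass K A A] (f : X → A) (a : X) :
    FreeAssoc.lift K f (FreeAssoc.of K a) = f a := by
  simp [FreeAssoc.lift, FreeAssoc.of]

lemma FreeAssoc.hom_ext (K : Type u) [Field K] {X : Type x} {A : Type w} [NonUnitalRing A]
    [Module K A] [IsScalarTower K A A] [SMulCommClass K A A] {f g : FreeAssoc K X →ₙₐ[K] A}
    (h : ∀ a, f (FreeAssoc.of K a) = g (FreeAssoc.of K a)) : f = g := by
  apply (MonoidAlgebra.liftMagma K).symm.injective
  apply FreeSemigroup.hom_ext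
  funext a
  exact h a

namespace LeavittPathAlgebra

open Generator

/-- The defining relations of the Leavitt path algebra.  The relation (CK2) is imposed exactly at
the regular vertices, i.e. those that emit at least one and only finitely many edges. -/
inductive Rel (K : Type u) [Field K] (E : DirectedGraph.{v, w}) :
    FreeAssoc K (Generator E) → FreeAssoc K (Generator E) → Prop
  | V_same (a : E.Vertex) :
      Rel K E (FreeAssoc.of K (vertex a) * FreeAssoc.of K (vertex a)) (FreeAssoc.of K (vertex a))
  | V_ne (a b : E.Vertex) (h : a ≠ b) :
      Rel K E (FreeAssoc.of K (vertex a) * FreeAssoc.of K (vertex b)) 0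
  | E1_left (e : E.Edge) :
      Rel K E (FreeAssoc.of K (vertex (E.s e)) * FreeAssoc.of K (edge e)) (FreeAssoc.of K (edge e))
  | E1_right (e : E.Edge) :
      Rel K E (FreeAssoc.of K (edge e) * FreeAssoc.of K (vertex (E.r e))) (FreeAssoc.of K (edge e))
  | E2_left (e : E.Edge) :
      Rel K E (FreeAssoc.of K (vertex (E.r e)) * FreeAssoc.of K (ghost e))
        (FreeAssoc.of K (ghost e))
  | E2_right (e : E.Edge) :
      Rel K E (FreeAssoc.of K (ghost e) * FreeAssoc.of K (vertex (E.s e)))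
        (FreeAssoc.of K (ghost e))
  | CK1_same (e : E.Edge) :
      Rel K E (FreeAssoc.of K (ghost e) * FreeAssoc.of K (edge e))
        (FreeAssoc.of K (vertex (E.r e)))
  | CK1_ne (e f : E.Edge) (h : e ≠ f) :
      Rel K E (FreeAssoc.of K (ghost e) * FreeAssoc.of K (edge f)) 0
  | CK2 (a : E.Vertex) (hne : {e | E.s e = a}.Nonempty) (hfin : {e | E.s e = a}.Finite) :
      Rel K E (FreeAssoc.of K (vertex a))
        (∑ e ∈ hfin.toFinset, FreeAssoc.of K (edge e) * FreeAssoc.of K (ghost e))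

/-- The congruence of non-unital `K`-algebras generated by the defining relations.  (Without a
unit, compatibility with scalars is not automatic, so scalar multiples of the relations are
included.) -/
def con (K : Type u) [Field K] (E : DirectedGraph.{v, w}) : RingCon (FreeAssoc K (Generator E)) :=
  ringConGen fun a b => ∃ (k : K) (a' b' : FreeAssoc K (Generator E)),
    Rel K E a' b' ∧ a = k • a' ∧ b = k • b'

lemma con_smul {K : Type u} [Field K] {E : DirectedGraph.{v, w}} (k : K)
    {a b : FreeAssoc K (Generator E)} (h : con K E a b) : con K E (k • a) (k • b) := by
  induction h with
  | of a b h =>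
    obtain ⟨l, a', b', hr, rfl, rfl⟩ := h
    exact RingConGen.Rel.of _ _ ⟨k * l, a', b', hr, by rw [mul_smul], by rw [mul_smul]⟩
  | refl a => exact RingConGen.Rel.refl _
  | symm _ ih => exact RingConGen.Rel.symm ih
  | trans _ _ ih₁ ih₂ => exact RingConGen.Rel.trans ih₁ ih₂
  | add _ _ ih₁ ih₂ => rw [smul_add, smul_add]; exact RingConGen.Rel.add ih₁ ih₂
  | mul _ h₂ ih₁ _ =>
    rw [← smul_mul_assoc, ← smul_mul_assoc]; exact RingConGen.Rel.mul ih₁ h₂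

end LeavittPathAlgebra

/-- The Leavitt path algebra `L_K(E)`: the free associative `K`-algebra on `E⁰ ∪ E¹ ∪ (E¹)*`
modulo the relations (V), (E1), (E2), (CK1), (CK2).  It is not assumed to have a unit. -/
def LeavittPathAlgebra (K : Type u) [Field K] (E : DirectedGraph.{v, w}) : Type (max u v w) :=
  (LeavittPathAlgebra.con K E).Quotient

namespace LeavittPathAlgebra

open Generator

variable {K : Type u} [Field K] {E : DirectedGraph.{v, w}}

instance : NonUnitalRing (LeavittPathAlgebra K E) :=
  inferInstanceAs (NonUnitalRing (con K E).Quotient)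

/-- The quotient map from the free algebra. -/
def mk (a : FreeAssoc K (Generator E)) : LeavittPathAlgebra K E := (a : (con K E).Quotient)

lemma mk_surjective : Function.Surjective (mk : FreeAssoc K (Generator E) → _) :=
  fun x => Quotient.inductionOn' x fun a => ⟨a, rfl⟩

lemma mk_eq_mk {a b : FreeAssoc K (Generator E)} : mk a = mk b ↔ con K E a b :=
  RingCon.eq _

lemma mk_add (a b : FreeAssoc K (Generator E)) : mk (a + b) = mk a + mk b := rfl

lemma mk_mul (a b : FreeAssoc K (Generator E)) : mk (a * b) = mk a * mk b := rfl

lemma mk_zero : mk (0 : FreeAssoc K (Generator E)) = 0 := rfl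

instance : SMul K (LeavittPathAlgebra K E) :=
  ⟨fun k => Quotient.map' (k • ·) fun _ _ h => con_smul k h⟩

lemma mk_smul (k : K) (a : FreeAssoc K (Generator E)) : mk (k • a) = k • mk a := rfl

instance : Module K (LeavittPathAlgebra K E) where
  one_smul x := by
    obtain ⟨a, rfl⟩ := mk_surjective x
    rw [← mk_smul, one_smul]
  mul_smul k l x := by
    obtain ⟨a, rfl⟩ := mk_surjective x
    simp only [← mk_smul, mul_smul]
  smul_zero k := by rw [← mk_zero, ← mk_smul, smul_zero]
  smul_add k x y := by
    obtain ⟨a, rfl⟩ := mk_surjective x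
    obtain ⟨b, rfl⟩ := mk_surjective y
    simp only [← mk_smul, ← mk_add, smul_add]
  add_smul k l x := by
    obtain ⟨a, rfl⟩ := mk_surjective x
    simp only [← mk_smul, ← mk_add, add_smul]
  zero_smul x := by
    obtain ⟨a, rfl⟩ := mk_surjective x
    rw [← mk_smul, zero_smul, mk_zero]

instance : IsScalarTower K (LeavittPathAlgebra K E) (LeavittPathAlgebra K E) where
  smul_assoc k x y := by
    obtain ⟨a, rfl⟩ := mk_surjective x
    obtain ⟨b, rfl⟩ := mk_surjective y
    simp only [smul_eq_mul, ← mk_smul, ← mk_mul, smul_mul_assoc]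

instance : SMulCommClass K (LeavittPathAlgebra K E) (LeavittPathAlgebra K E) where
  smul_comm k x y := by
    obtain ⟨a, rfl⟩ := mk_surjective x
    obtain ⟨b, rfl⟩ := mk_surjective y
    simp only [smul_eq_mul, ← mk_smul, ← mk_mul, mul_smul_comm]

/-- The quotient map as a homomorphism of non-unital algebras. -/
def mkHom : FreeAssoc K (Generator E) →ₙₐ[K] LeavittPathAlgebra K E where
  toFun := mk
  map_smul' := mk_smul
  map_zero' := mk_zero
  map_add' := mk_add
  map_mul' := mk_mul

/-- The image of a generator in `L_K(E)`. -/
def gen (K : Type u) [Field K] {E : DirectedGraph.{v, w}} (g : Generator E) :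
    LeavittPathAlgebra K E := mk (FreeAssoc.of K g)

lemma mk_eq_of_rel {a b : FreeAssoc K (Generator E)} (h : Rel K E a b) : mk a = mk b :=
  mk_eq_mk.2 (RingConGen.Rel.of _ _ ⟨1, a, b, h, (one_smul _ _).symm, (one_smul _ _).symm⟩)

section lift

variable {A : Type x} [NonUnitalRing A] [Module K A] [IsScalarTower K A A] [SMulCommClass K A A]

/-- The universal property: a map of the generators into a `K`-algebra that respects the defining
relations extends to a homomorphism of `K`-algebras. -/
def lift (f : Generator E → A)
    (hf : ∀ a b, Rel K E a b → FreeAssoc.lift K f a = FreeAssoc.lift K f b) :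
    LeavittPathAlgebra K E →ₙₐ[K] A :=
  have key : ∀ a b, con K E a b → FreeAssoc.lift K f a = FreeAssoc.lift K f b := by
    intro a b h
    induction h with
    | of a b h =>
      obtain ⟨l, a', b', hr, rfl, rfl⟩ := h
      rw [map_smul, map_smul, hf _ _ hr]
    | refl a => rfl
    | symm _ ih => exact ih.symm
    | trans _ _ ih₁ ih₂ => exact ih₁.trans ih₂
    | add _ _ ih₁ ih₂ => rw [map_add, map_add, ih₁, ih₂]
    | mul _ _ ih₁ ih₂ => rw [map_mul, map_mul, ih₁, ih₂]
  { toFun := fun y => Quotient.liftOn' y (FreeAssoc.lift K f) key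
    map_smul' := by
      intro k y
      obtain ⟨a, rfl⟩ := mk_surjective y
      exact map_smul (FreeAssoc.lift K f) k a
    map_zero' := map_zero (FreeAssoc.lift K f)
    map_add' := by
      intro y z
      obtain ⟨a, rfl⟩ := mk_surjective y
      obtain ⟨b, rfl⟩ := mk_surjective z
      exact map_add (FreeAssoc.lift K f) a b
    map_mul' := by
      intro y z
      obtain ⟨a, rfl⟩ := mk_surjective y
      obtain ⟨b, rfl⟩ := mk_surjective z
      exact map_mul (FreeAssoc.lift K f) a b }

lemma lift_mk (f : Generator E → A)
    (hf : ∀ a b, Rel K E a b → FreeAssoc.lift K f a = FreeAssoc.lift K f b)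
    (a : FreeAssoc K (Generator E)) : lift f hf (mk a) = FreeAssoc.lift K f a := rfl

lemma lift_gen (f : Generator E → A)
    (hf : ∀ a b, Rel K E a b → FreeAssoc.lift K f a = FreeAssoc.lift K f b)
    (g : Generator E) : lift f hf (gen K g) = f g :=
  (lift_mk f hf _).trans (FreeAssoc.lift_of K f g)

lemma hom_ext {f g : LeavittPathAlgebra K E →ₙₐ[K] A}
    (h : ∀ a, f (gen K a) = g (gen K a)) : f = g := by
  have : f.comp mkHom = g.comp mkHom := FreeAssoc.hom_ext K h
  ext y
  obtain ⟨a, rfl⟩ := mk_surjective y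
  exact DFunLike.congr_fun this a

end lift

/-- The standard involution, as a homomorphism into the opposite algebra: it is the `K`-linear
anti-homomorphism with `v ↦ v`, `e ↦ e*`, `e* ↦ e`. -/
def starHom : LeavittPathAlgebra K E →ₙₐ[K] (LeavittPathAlgebra K E)ᵐᵒᵖ :=
  lift (fun g => MulOpposite.op (gen K g.conj)) (by
    intro a b h
    cases h with
    | V_same a =>
      simp only [map_mul, FreeAssoc.lift_of, ← MulOpposite.op_mul, MulOpposite.op_inj]
      exact mk_eq_of_rel (.V_same a)
    | V_ne a b h =>
      simp only [map_mul, map_zero, FreeAssoc.lift_of, ← MulOpposite.op_mul,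
        MulOpposite.op_eq_zero_iff]
      exact mk_eq_of_rel (.V_ne b a h.symm)
    | E1_left e =>
      simp only [map_mul, FreeAssoc.lift_of, ← MulOpposite.op_mul, MulOpposite.op_inj]
      exact mk_eq_of_rel (.E2_right e)
    | E1_right e =>
      simp only [map_mul, FreeAssoc.lift_of, ← MulOpposite.op_mul, MulOpposite.op_inj]
      exact mk_eq_of_rel (.E2_left e)
    | E2_left e =>
      simp only [map_mul, FreeAssoc.lift_of, ← MulOpposite.op_mul, MulOpposite.op_inj]
      exact mk_eq_of_rel (.E1_right e)
    | E2_right e =>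
      simp only [map_mul, FreeAssoc.lift_of, ← MulOpposite.op_mul, MulOpposite.op_inj]
      exact mk_eq_of_rel (.E1_left e)
    | CK1_same e =>
      simp only [map_mul, FreeAssoc.lift_of, ← MulOpposite.op_mul, MulOpposite.op_inj]
      exact mk_eq_of_rel (.CK1_same e)
    | CK1_ne e f h =>
      simp only [map_mul, map_zero, FreeAssoc.lift_of, ← MulOpposite.op_mul,
        MulOpposite.op_eq_zero_iff]
      exact mk_eq_of_rel (.CK1_ne f e h.symm)
    | CK2 a hne hfin =>
      simp only [map_sum, map_mul, FreeAssoc.lift_of, ← MulOpposite.op_mul,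
        ← Finset.op_sum, MulOpposite.op_inj]
      refine (mk_eq_of_rel (.CK2 a hne hfin)).trans ?_
      exact map_sum (mkHom (K := K) (E := E)) _ _)

/-- The standard involution of `L_K(E)`. -/
instance : Star (LeavittPathAlgebra K E) := ⟨fun y => (starHom y).unop⟩

lemma star_def (y : LeavittPathAlgebra K E) : star y = (starHom y).unop := rfl

@[simp] lemma star_gen (g : Generator E) : star (gen K g) = gen K g.conj := by
  rw [star_def, starHom, lift_gen, MulOpposite.unop_op]

lemma star_mul_rev (y z : LeavittPathAlgebra K E) : star (y * z) = star z * star y := by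
  simp only [star_def, map_mul, MulOpposite.unop_mul]

lemma star_add_add (y z : LeavittPathAlgebra K E) : star (y + z) = star y + star z := by
  simp only [star_def, map_add, MulOpposite.unop_add]

/-- The standard involution is `K`-linear. -/
lemma star_smul_smul (k : K) (y : LeavittPathAlgebra K E) : star (k • y) = k • star y := by
  simp only [star_def, map_smul, MulOpposite.unop_smul]

lemma star_star_self (y : LeavittPathAlgebra K E) : star (star y) = y := by
  let f : LeavittPathAlgebra K E →ₙₐ[K] LeavittPathAlgebra K E :=
    { toFun := fun y => star (star y)
      map_smul' := fun k y => by simp only [star_smul_smul, MonoidHom.id_apply]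
      map_zero' := by simp only [star_def, map_zero, MulOpposite.unop_zero]
      map_add' := fun y z => by simp only [star_add_add]
      map_mul' := fun y z => by simp only [star_mul_rev] }
  have hf : f = NonUnitalAlgHom.id K (LeavittPathAlgebra K E) := by
    apply hom_ext
    intro g
    change star (star (gen K g)) = gen K g
    rw [star_gen, star_gen]
    cases g <;> rfl
  exact DFunLike.congr_fun hf y

instance : StarRing (LeavittPathAlgebra K E) where
  star_involutive := star_star_self
  star_mul := star_mul_rev
  star_add := star_add_add

end LeavittPathAlgebra

/-- A simple ring, not necessarily with unit: the multiplication is not identically zero, and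
there are exactly two two-sided ideals, zero and the whole ring. -/
def IsSimpleNonUnitalRing (A : Type x) [NonUnitalRing A] : Prop :=
  (∃ a b : A, a * b ≠ 0) ∧ IsSimpleRing A

/-- An involution of the first kind: it fixes the center elementwise. -/
def IsFirstKind (A : Type x) [NonUnitalRing A] [StarRing A] : Prop :=
  ∀ a ∈ Set.center A, star a = a

/-- The set `K_A` of skew-symmetric elements. -/
def skewElements (A : Type x) [NonUnitalRing A] [StarRing A] : Set A :=
  {a | star a = -a}

/-- `[I, I]`: the `K`-subspace spanned by the commutators `ab - ba` with `a, b ∈ I`. -/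
def commutatorSpan (K : Type u) [Field K] {A : Type x} [NonUnitalRing A] [Module K A]
    (I : Set A) : Submodule K A :=
  Submodule.span K {c | ∃ a ∈ I, ∃ b ∈ I, c = a * b - b * a}

end

/-!
Let `X` be the set of infinite paths of `E`; it is nonempty because a cycle can be run through
forever. The algebra `L = L_K(E)` acts on the vector space with basis `X`: edges prepend themselves
and ghost edges remove an initial edge (`pathRep`). The standard involution acts as the adjoint for
the bilinear form in which `X` is orthonormal (`pathForm_star`).

*First kind.* A central `z` commutes with the edges, so `z (e x) = e (z x)`: all paths in the support
of `z x` begin with the first edge of `x`, and by iteration `z x` is a multiple of `x`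
(`pathRep_center_apply`). Thus `z` is diagonal and coincides with its adjoint `z*` on `X`. If `L` is
simple, the representation is faithful, whence `z* = z` (`isFirstKind`).

*Skew elements.* A word `g₁ ⋯ gₘ` in the generators acts on `X` as a partial injection. If its degree
`n` for the standard `ℤ`-grading is not zero, it changes the length of the common initial part of two
distinct paths by `n`, so it has at most one fixed point. Hence the degree `n` part of `L` has a
well-defined trace (`degreeTrace`), which vanishes on all commutators since fixed points of `uv`
correspond to those of `vu`. A cycle `c` of length `n` fixes `c c c ⋯`, and `c*` has degree `-n`, so
the skew element `c - c*` has trace `1` and is not in `[K_L, K_L]`. This works in every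
characteristic, including `2`, and does not use simplicity.

*Roses.* For `n ≥ 2` and `a ≠ 0` in `L_K(R_n)`, some product `a q` with a long path `q` is a nonzero
linear combination of real paths. If `l₀` is a path of minimal length in it, there is a path `s` such
that `(l₀ s)* l s = 0` for all other paths `l` in it, so `(l₀ s)* a q s` is a nonzero scalar
(`exists_mul_mul_eq_roseOne`), and `L_K(R_n)` is simple. `R_2` answers the general question.
-/

noncomputable section

/-! ### Infinite paths -/

namespace DirectedGraph

variable {E : DirectedGraph.{v, w}}

/-- The infinite paths `x₀ x₁ x₂ ⋯` of a graph, `r(xᵢ) = s(xᵢ₊₁)`. -/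
def InfinitePath (E : DirectedGraph.{v, w}) : Type w :=
  {x : ℕ → E.Edge // ∀ i, E.r (x i) = E.s (x (i + 1))}

namespace InfinitePath

/-- The shift, which removes the first edge. -/
def tail (x : E.InfinitePath) : E.InfinitePath :=
  ⟨fun i => x.1 (i + 1), fun i => x.2 (i + 1)⟩

/-- Prepend an edge to an infinite path. -/
def cons (e : E.Edge) (x : E.InfinitePath) (h : E.r e = E.s (x.1 0)) : E.InfinitePath :=
  ⟨fun i => Nat.casesOn i e x.1, fun i => by cases i; exacts [h, x.2 _]⟩

@[simp] lemma cons_zero (e : E.Edge) (x : E.InfinitePath) (h : E.r e = E.s (x.1 0)) :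
    (x.cons e h).1 0 = e := rfl

@[simp] lemma tail_cons (e : E.Edge) (x : E.InfinitePath) (h : E.r e = E.s (x.1 0)) :
    (x.cons e h).tail = x := rfl

lemma r_zero (x : E.InfinitePath) : E.r (x.1 0) = E.s (x.tail.1 0) := x.2 0

lemma ext_tail {x y : E.InfinitePath} (h : x.1 0 = y.1 0) (ht : x.tail = y.tail) : x = y := by
  apply Subtype.ext
  funext i
  cases i with
  | zero => exact h
  | succ i => exact congrFun (congrArg Subtype.val ht) i

@[simp] lemma cons_tail (x : E.InfinitePath) (h : E.r (x.1 0) = E.s (x.tail.1 0)) :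
    x.tail.cons (x.1 0) h = x := ext_tail rfl rfl

lemma cons_eq_iff {e : E.Edge} {x y : E.InfinitePath} (h : E.r e = E.s (x.1 0)) :
    x.cons e h = y ↔ y.1 0 = e ∧ y.tail = x := by
  constructor
  · rintro rfl
    exact ⟨rfl, rfl⟩
  · rintro ⟨rfl, rfl⟩
    exact cons_tail _ _

end InfinitePath

/-- Running around a cycle forever: the infinite path whose first edges are the edges of the cycle
and which is periodic with the length of the cycle as a period. -/
lemma IsCycle.exists_infinitePath {l : List E.Edge} (hl : E.IsCycle l) :
    ∃ x : E.InfinitePath, (∀ i (hi : i < l.length), x.1 i = l[i]) ∧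
      InfinitePath.tail^[l.length] x = x := by
  obtain ⟨hne, hchain, hclose, -⟩ := hl
  have hpos : 0 < l.length := List.length_pos_iff.2 hne
  have hx : ∀ i, E.r (l[i % l.length]'(Nat.mod_lt _ hpos)) =
      E.s (l[(i + 1) % l.length]'(Nat.mod_lt _ hpos)) := by
    intro i
    have hi := Nat.mod_lt i hpos
    rcases Nat.lt_or_ge (i % l.length + 1) l.length with h | h
    · have h1 : (i + 1) % l.length = i % l.length + 1 := by
        rw [Nat.add_mod, Nat.mod_eq_of_lt (a := 1) (by omega), Nat.mod_eq_of_lt h]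
      simp only [h1]
      exact List.isChain_iff_getElem.1 hchain _ h
    · have h0 : i % l.length = l.length - 1 := by omega
      have h1 : (i + 1) % l.length = 0 := by
        rw [Nat.add_mod, h0]
        rcases Nat.lt_or_ge 1 l.length with h2 | h2
        · rw [Nat.mod_eq_of_lt h2, Nat.sub_add_cancel hpos, Nat.mod_self]
        · have : l.length = 1 := by omega
          simp [this]
      simp only [h0, h1]
      rw [← List.getLast_eq_getElem hne, ← List.head_eq_getElem hne]
      exact hclose
  refine ⟨⟨fun i => l[i % l.length]'(Nat.mod_lt _ hpos), hx⟩, fun i hi => ?_, ?_⟩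
  · simp only [Nat.mod_eq_of_lt hi]
  · have key : ∀ (k : ℕ) (x : E.InfinitePath) (i : ℕ),
        (InfinitePath.tail^[k] x).1 i = x.1 (i + k) := by
      intro k
      induction k with
      | zero => intro x i; rfl
      | succ k ih =>
        intro x i
        rw [Function.iterate_succ_apply, ih]
        exact congrArg x.1 (by omega)
    apply Subtype.ext
    funext i
    exact (key _ _ _).trans (by simp only [Nat.add_mod_right])

end DirectedGraph

/-! ### The representation on infinite paths and the centre -/

namespace LeavittPathAlgebra

open DirectedGraph Generator

open scoped Classical in
/-- The operator by which a generator acts on the vector space with basis the infinite paths: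
a vertex `a` is the projection to the paths starting at `a`, an edge prepends itself where this
is possible, and a ghost edge `e*` removes the initial edge `e` and kills the paths that do not
start with `e`. -/
def genAct (K : Type u) [Field K] {E : DirectedGraph.{v, w}} :
    Generator E → Module.End K (E.InfinitePath →₀ K)
  | vertex a => Finsupp.linearCombination K fun x =>
      if E.s (x.1 0) = a then Finsupp.single x 1 else 0
  | edge e => Finsupp.linearCombination K fun x =>
      if h : E.r e = E.s (x.1 0) then Finsupp.single (x.cons e h) 1 else 0
  | ghost e => Finsupp.linearCombination K fun x =>
      if x.1 0 = e then Finsupp.single x.tail 1 else 0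

variable {K : Type u} [Field K] {E : DirectedGraph.{v, w}}

open scoped Classical in
lemma genAct_vertex (a : E.Vertex) (x : E.InfinitePath) :
    genAct K (vertex a) (Finsupp.single x 1) =
      if E.s (x.1 0) = a then Finsupp.single x 1 else 0 := by
  simp [genAct]

open scoped Classical in
lemma genAct_edge (e : E.Edge) (x : E.InfinitePath) :
    genAct K (edge e) (Finsupp.single x 1) =
      if h : E.r e = E.s (x.1 0) then Finsupp.single (x.cons e h) 1 else 0 := by
  simp [genAct]

open scoped Classical in
lemma genAct_ghost (e : E.Edge) (x : E.InfinitePath) :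
    genAct K (ghost e) (Finsupp.single x 1) =
      if x.1 0 = e then Finsupp.single x.tail 1 else 0 := by
  simp [genAct]

lemma endo_ext {f g : Module.End K (E.InfinitePath →₀ K)}
    (h : ∀ x, f (Finsupp.single x 1) = g (Finsupp.single x 1)) : f = g :=
  Finsupp.lhom_ext' fun x => LinearMap.ext_ring (h x)

/-- The representation of `L_K(E)` on the vector space with basis the infinite paths. -/
def pathRep (K : Type u) [Field K] (E : DirectedGraph.{v, w}) :
    LeavittPathAlgebra K E →ₙₐ[K] Module.End K (E.InfinitePath →₀ K) :=
  lift (A := Module.End K (E.InfinitePath →₀ K)) (genAct K) (by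
    classical
    intro a b h
    cases h with
    | CK2 a hne hfin =>
      simp only [map_sum, map_mul, FreeAssoc.lift_of]
      refine endo_ext fun x => ?_
      have key : ∀ e, (genAct K (edge e) * genAct K (ghost e)) (Finsupp.single x 1) =
          if e = x.1 0 then Finsupp.single x 1 else 0 := by
        intro e
        rw [Module.End.mul_apply, genAct_ghost]
        by_cases he : x.1 0 = e
        · subst he
          simp [genAct_edge, x.r_zero]
        · simp [he, Ne.symm he]
      rw [LinearMap.sum_apply, Finset.sum_congr rfl fun e _ => key e, Finset.sum_ite_eq',
        genAct_vertex]
      simp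
    | _ =>
      simp only [map_mul, map_zero, FreeAssoc.lift_of]
      refine endo_ext fun x => ?_
      simp only [Module.End.mul_apply, genAct_vertex, genAct_edge, genAct_ghost,
        LinearMap.zero_apply]
      split_ifs <;> simp_all [genAct_vertex, genAct_edge, genAct_ghost] <;>
        grind [InfinitePath.r_zero])

@[simp] lemma pathRep_gen (g : Generator E) : pathRep K E (gen K g) = genAct K g :=
  lift_gen _ _ _

/-- `L_K(E)` is generated by the vertices, the edges and the ghost edges. -/
lemma induction_gen {p : LeavittPathAlgebra K E → Prop} (gen : ∀ g, p (gen K g))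
    (zero : p 0) (add : ∀ a b, p a → p b → p (a + b)) (smul : ∀ (k : K) a, p a → p (k • a))
    (mul : ∀ g b, p b → p (LeavittPathAlgebra.gen K g * b)) (a : LeavittPathAlgebra K E) :
    p a := by
  obtain ⟨a, rfl⟩ := mk_surjective a
  induction a using MonoidAlgebra.induction_linear with
  | zero => exact zero
  | add a b ha hb => exact add _ _ ha hb
  | single w k =>
    have : (MonoidAlgebra.single w k : FreeAssoc K (Generator E)) =
        k • MonoidAlgebra.single w 1 := by simp
    rw [this, mk_smul]
    refine smul _ _ ?_
    induction w using FreeSemigroup.recOnMul with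
    | ih1 g => exact gen g
    | ih2 g w _ ih =>
      have : (MonoidAlgebra.single (FreeSemigroup.of g * w) 1 : FreeAssoc K (Generator E)) =
        FreeAssoc.of K g * MonoidAlgebra.single w 1 := by
          simp [FreeAssoc.of]
      rw [this, mk_mul]
      exact mul _ _ (ih (by simp))

/-- The symmetric bilinear form for which the infinite paths are orthonormal. -/
def pathForm (K : Type u) [Field K] (E : DirectedGraph.{v, w}) :
    (E.InfinitePath →₀ K) →ₗ[K] (E.InfinitePath →₀ K) →ₗ[K] K :=
  Finsupp.linearCombination K fun x => Finsupp.lapply x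

lemma pathForm_single (x : E.InfinitePath) (f : E.InfinitePath →₀ K) :
    pathForm K E (Finsupp.single x 1) f = f x := by
  simp [pathForm]

lemma pathForm_single_right (x : E.InfinitePath) (f : E.InfinitePath →₀ K) :
    pathForm K E f (Finsupp.single x 1) = f x := by
  classical
  have : (pathForm K E).flip (Finsupp.single x 1) = Finsupp.lapply x := by
    refine Finsupp.lhom_ext' fun y => LinearMap.ext_ring ?_
    simp [pathForm_single, Finsupp.single_apply, eq_comm]
  exact LinearMap.congr_fun this f

/-- The standard involution acts as the adjoint with respect to `pathForm`. -/
lemma pathForm_star (a : LeavittPathAlgebra K E) (f g : E.InfinitePath →₀ K) :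
    pathForm K E (pathRep K E a f) g = pathForm K E f (pathRep K E (star a) g) := by
  classical
  have hgen : ∀ (c : Generator E) (f g : E.InfinitePath →₀ K),
      pathForm K E (genAct K c f) g = pathForm K E f (genAct K c.conj g) := by
    intro c f g
    have : (pathForm K E).comp (genAct K c) = (pathForm K E).compl₂ (genAct K c.conj) := by
      refine Finsupp.lhom_ext' fun x => LinearMap.ext_ring ?_
      refine Finsupp.lhom_ext' fun y => LinearMap.ext_ring ?_
      simp only [LinearMap.comp_apply, LinearMap.compl₂_apply, Finsupp.lsingle_apply,
        pathForm_single]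
      cases c with
      | vertex a =>
        simp only [Generator.conj, genAct_vertex]
        split_ifs <;> simp [pathForm_single, Finsupp.single_apply] <;> grind
      | edge e =>
        simp only [Generator.conj, genAct_edge, genAct_ghost]
        split_ifs <;> simp [pathForm_single, Finsupp.single_apply, InfinitePath.cons_eq_iff,
          eq_comm (a := y)] <;> grind [InfinitePath.r_zero]
      | ghost e =>
        simp only [Generator.conj, genAct_edge, genAct_ghost]
        split_ifs <;> simp [pathForm_single, Finsupp.single_apply, InfinitePath.cons_eq_iff] <;>
          grind [InfinitePath.r_zero]
    exact LinearMap.congr_fun (LinearMap.congr_fun this f) g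
  induction a using induction_gen generalizing f g with
  | zero => simp
  | add a b ha hb => simp [star_add, ha, hb]
  | smul k a ha => simp [star_smul_smul, ha]
  | gen c => simpa using hgen c f g
  | mul c b hb =>
    rw [map_mul, Module.End.mul_apply, pathRep_gen, hgen, hb, star_mul, star_gen, map_mul,
      Module.End.mul_apply, pathRep_gen]

/-- Central elements act diagonally: writing `x = e x'`, the vector `z x = e (z x')` is supported
on paths that begin with `e`, and by iteration on paths that agree with `x` everywhere. -/
lemma pathRep_center_apply {z : LeavittPathAlgebra K E}
    (hz : z ∈ Set.center (LeavittPathAlgebra K E)) {x y : E.InfinitePath}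
    (h : pathRep K E z (Finsupp.single x 1) y ≠ 0) : y = x := by
  classical
  have step : ∀ x y : E.InfinitePath, pathRep K E z (Finsupp.single x 1) y ≠ 0 →
      y.1 0 = x.1 0 ∧ pathRep K E z (Finsupp.single x.tail 1) y.tail ≠ 0 := by
    intro x y hxy
    have h1 : pathRep K E z (Finsupp.single x 1) =
        genAct K (edge (x.1 0)) (pathRep K E z (Finsupp.single x.tail 1)) := by
      have h2 : (Finsupp.single x 1 : E.InfinitePath →₀ K) =
          genAct K (edge (x.1 0)) (Finsupp.single x.tail 1) := by
        simp [genAct_edge, x.r_zero]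
      rw [h2, ← pathRep_gen, ← Module.End.mul_apply, ← Module.End.mul_apply, ← map_mul, ← map_mul,
        hz.comm]
    have h3 : ∀ f : E.InfinitePath →₀ K, genAct K (edge (x.1 0)) f y =
        if y.1 0 = x.1 0 then f y.tail else 0 := by
      intro f
      have := pathForm_star (gen K (ghost (x.1 0))) (Finsupp.single y 1) f
      rw [star_gen, pathRep_gen, pathRep_gen, pathForm_single, genAct_ghost] at this
      rw [Generator.conj] at this
      rw [← this]
      split_ifs <;> simp [pathForm_single]
    rw [h1, h3] at hxy
    simpa using hxy
  have all : ∀ (i : ℕ) (x y : E.InfinitePath), pathRep K E z (Finsupp.single x 1) y ≠ 0 →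
      y.1 i = x.1 i := by
    intro i
    induction i with
    | zero => exact fun x y h => (step x y h).1
    | succ i ih => exact fun x y h => ih _ _ (step x y h).2
  exact Subtype.ext (funext fun i => all i x y h)

/-- A vertex through which an infinite path passes is not killed, so the representation on the
infinite paths of a simple Leavitt path algebra is faithful. -/
lemma pathRep_injective (hs : IsSimpleRing (LeavittPathAlgebra K E)) (x : E.InfinitePath) :
    Function.Injective (pathRep K E) := by
  rw [← TwoSidedIdeal.ker_eq_bot]
  refine (eq_bot_or_eq_top _).resolve_right fun h => ?_
  have h1 : gen K (vertex (E.s (x.1 0))) ∈ TwoSidedIdeal.ker (pathRep K E) := by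
    rw [h]; trivial
  rw [TwoSidedIdeal.mem_ker, pathRep_gen] at h1
  have h2 := LinearMap.congr_fun h1 (Finsupp.single x 1)
  rw [genAct_vertex, if_pos rfl] at h2
  simp at h2

/-- The vectors `z x` and `z* x` are multiples of `x`, with the same coefficient because `z*` acts as
the adjoint of `z`; by faithfulness `z* = z`. -/
lemma isFirstKind (hs : IsSimpleRing (LeavittPathAlgebra K E)) (x : E.InfinitePath) :
    IsFirstKind (LeavittPathAlgebra K E) := by
  intro z hz
  apply pathRep_injective hs x
  refine endo_ext fun x => Finsupp.ext fun y => ?_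
  have h : ∀ b : LeavittPathAlgebra K E, pathRep K E (star b) (Finsupp.single x 1) y =
      pathRep K E b (Finsupp.single y 1) x := by
    intro b
    have h := pathForm_star b (Finsupp.single y 1) (Finsupp.single x 1)
    rw [pathForm_single, pathForm_single_right] at h
    exact h.symm
  rw [h]
  by_cases hxy : y = x
  · rw [hxy]
  · rw [not_imp_comm.1 (pathRep_center_apply hz) hxy,
      not_imp_comm.1 (pathRep_center_apply hz) (Ne.symm hxy)]

end LeavittPathAlgebra

/-! ### The trace in a nonzero degree -/

namespace DirectedGraph

variable {E : DirectedGraph.{v, w}}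

/-- The degree of a generator for the standard `ℤ`-grading of the Leavitt path algebra. -/
def Generator.degree : Generator E → ℤ
  | vertex _ => 0
  | edge _ => 1
  | ghost _ => -1

/-- The degree of a word in the generators. -/
def wordDegree (l : List (Generator E)) : ℤ := (l.map Generator.degree).sum

@[simp] lemma wordDegree_cons (g : Generator E) (l : List (Generator E)) :
    wordDegree (g :: l) = g.degree + wordDegree l := by simp [wordDegree]

@[simp] lemma wordDegree_append (l m : List (Generator E)) :
    wordDegree (l ++ m) = wordDegree l + wordDegree m := by simp [wordDegree]

namespace InfinitePath

/-- The graph of the partial injection of the infinite paths given by a generator: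
`Step g x y` says that `g` sends `x` to `y`. -/
def Step : Generator E → E.InfinitePath → E.InfinitePath → Prop
  | .vertex a, x, y => x = y ∧ E.s (x.1 0) = a
  | .edge e, x, y => y.1 0 = e ∧ y.tail = x
  | .ghost e, x, y => x.1 0 = e ∧ x.tail = y

/-- The graph of the partial injection of the infinite paths given by a word, whose last letter
acts first. -/
def Run : List (Generator E) → E.InfinitePath → E.InfinitePath → Prop
  | [], x, y => x = y
  | g :: l, x, y => ∃ z, Run l x z ∧ Step g z y

lemma run_append {l m : List (Generator E)} {x y : E.InfinitePath} :
    Run (l ++ m) x y ↔ ∃ z, Run m x z ∧ Run l z y := by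
  induction l generalizing y with
  | nil => simp [Run]
  | cons g l ih =>
    simp only [List.cons_append, Run, ih]
    grind

lemma run_edges (l : List E.Edge) (y : E.InfinitePath)
    (h : ∀ i (hi : i < l.length), y.1 i = l[i]) :
    Run (l.map .edge) (tail^[l.length] y) y := by
  induction l generalizing y with
  | nil => rfl
  | cons e l ih =>
    refine ⟨y.tail, ih _ fun i hi => ?_, h 0 (by simp), rfl⟩
    exact h (i + 1) (by simpa using hi)

lemma firstDiff_tail {x y : E.InfinitePath} (h : x.1 0 = y.1 0) (hne : x ≠ y) :
    PiNat.firstDiff x.1 y.1 = PiNat.firstDiff x.tail.1 y.tail.1 + 1 := by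
  have hne' : x.1 ≠ y.1 := fun h => hne (Subtype.ext h)
  have ht : x.tail.1 ≠ y.tail.1 := fun ht => hne (ext_tail h (Subtype.ext ht))
  have h1 := PiNat.apply_firstDiff_ne hne'
  have h2 := PiNat.apply_firstDiff_ne ht
  rcases lt_trichotomy (PiNat.firstDiff x.1 y.1) (PiNat.firstDiff x.tail.1 y.tail.1 + 1)
    with hlt | heq | hgt
  · rcases hk : PiNat.firstDiff x.1 y.1 with _ | k
    · rw [hk] at h1
      exact absurd h h1
    · rw [hk] at h1 hlt
      exact absurd (PiNat.apply_eq_of_lt_firstDiff (Nat.lt_of_succ_lt_succ hlt)) h1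
  · exact heq
  · exact absurd (PiNat.apply_eq_of_lt_firstDiff hgt) h2

lemma Step.firstDiff {g : Generator E} {x y x' y' : E.InfinitePath} (h : Step g x y)
    (h' : Step g x' y') (hne : x ≠ x') :
    y ≠ y' ∧ (PiNat.firstDiff y.1 y'.1 : ℤ) = g.degree + PiNat.firstDiff x.1 x'.1 := by
  cases g with
  | vertex a =>
    obtain ⟨rfl, -⟩ := h
    obtain ⟨rfl, -⟩ := h'
    exact ⟨hne, by simp [Generator.degree]⟩
  | edge e =>
    obtain ⟨h1, rfl⟩ := h
    obtain ⟨h2, rfl⟩ := h'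
    have hy : y ≠ y' := fun h => hne (congrArg tail h)
    exact ⟨hy, by rw [firstDiff_tail (h1.trans h2.symm) hy]; simp [Generator.degree, add_comm]⟩
  | ghost e =>
    obtain ⟨h1, rfl⟩ := h
    obtain ⟨h2, rfl⟩ := h'
    have h0 := h1.trans h2.symm
    exact ⟨fun h => hne (ext_tail h0 h), by
      rw [firstDiff_tail h0 hne]; simp [Generator.degree]⟩

lemma Run.firstDiff {l : List (Generator E)} {x y x' y' : E.InfinitePath} (h : Run l x y)
    (h' : Run l x' y') (hne : x ≠ x') :
    y ≠ y' ∧ (PiNat.firstDiff y.1 y'.1 : ℤ) = wordDegree l + PiNat.firstDiff x.1 x'.1 := by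
  induction l generalizing y y' with
  | nil =>
    obtain rfl : x = y := h
    obtain rfl : x' = y' := h'
    exact ⟨hne, by simp [wordDegree]⟩
  | cons g l ih =>
    obtain ⟨z, hz, hg⟩ := h
    obtain ⟨z', hz', hg'⟩ := h'
    obtain ⟨hzz, h1⟩ := ih hz hz'
    obtain ⟨hy, h2⟩ := hg.firstDiff hg' hzz
    exact ⟨hy, by rw [h2, h1, wordDegree_cons, add_assoc]⟩

/-- A word of nonzero degree `d` changes the length of the common initial part of two different
paths by `d`, hence it fixes at most one infinite path. -/
lemma Run.eq_of_fixed {l : List (Generator E)} (hl : wordDegree l ≠ 0) {x y : E.InfinitePath}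
    (hx : Run l x x) (hy : Run l y y) : x = y := by
  by_contra hne
  have := (hx.firstDiff hy hne).2
  omega

end InfinitePath

end DirectedGraph

namespace LeavittPathAlgebra

open DirectedGraph Generator InfinitePath

variable {K : Type u} [Field K] {E : DirectedGraph.{v, w}}

open scoped Classical in
/-- For `n ≠ 0`, the trace of a word of degree `n` in its action on the infinite paths, i.e. the
number of its fixed points. As there is at most one, this is encoded as `1` or `0` according to
whether a fixed point exists. Words of a degree other than `n` have trace `0`. -/
def wordTrace (K : Type u) [Field K] {E : DirectedGraph.{v, w}} (n : ℤ)
    (l : List (Generator E)) : K :=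
  if wordDegree l = n ∧ ∃ x, Run l x x then 1 else 0

lemma wordTrace_eq_ite {n : ℤ} {l : List (Generator E)} {p : Prop} [Decidable p]
    (h : (wordDegree l = n ∧ ∃ x, Run l x x) ↔ p) : wordTrace K n l = if p then 1 else 0 := by
  by_cases hp : p
  · rw [wordTrace, if_pos (h.2 hp), if_pos hp]
  · rw [wordTrace, if_neg (mt h.1 hp), if_neg hp]

lemma wordTrace_congr {n : ℤ} {l m : List (Generator E)} (hd : wordDegree l = wordDegree m)
    (h : ∀ x y, Run l x y ↔ Run m x y) : wordTrace K n l = wordTrace K n m := by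
  classical
  exact wordTrace_eq_ite (by simp only [hd, h])

lemma wordTrace_append_comm (n : ℤ) (l m : List (Generator E)) :
    wordTrace K n (l ++ m) = wordTrace K n (m ++ l) := by
  classical
  refine wordTrace_eq_ite ?_
  simp only [wordDegree_append, add_comm, run_append]
  grind

lemma wordTrace_eq_zero {n : ℤ} {l : List (Generator E)} (h : ∀ x y, ¬ Run l x y) :
    wordTrace K n l = 0 := by
  simp [wordTrace, h]

/-- The list of letters of an element of the free semigroup. -/
def letters {X : Type x} (w : FreeSemigroup X) : List X := w.head :: w.tail

lemma letters_mul {X : Type x} (a b : FreeSemigroup X) :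
    letters (a * b) = letters a ++ letters b := rfl

lemma letters_of {X : Type x} (a : X) : letters (FreeSemigroup.of a) = [a] := rfl

/-- The linear functional on the free algebra that sends a word `u` to the degree `n` trace of
`u t`, for a possibly empty word `t`. -/
def freeTrace (K : Type u) [Field K] {E : DirectedGraph.{v, w}} (n : ℤ)
    (t : List (Generator E)) : FreeAssoc K (Generator E) →ₗ[K] K :=
  (MonoidAlgebra.basis (FreeSemigroup (Generator E)) K).constr K
    fun w => wordTrace K n (letters w ++ t)

lemma freeTrace_single (n : ℤ) (t : List (Generator E)) (w : FreeSemigroup (Generator E)) (k : K) :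
    freeTrace K n t (MonoidAlgebra.single w k) = k * wordTrace K n (letters w ++ t) := by
  have : (MonoidAlgebra.single w k : FreeAssoc K (Generator E)) =
      k • MonoidAlgebra.basis (FreeSemigroup (Generator E)) K w := by simp
  rw [this, map_smul, freeTrace, Module.Basis.constr_basis, smul_eq_mul]

lemma freeTrace_of (n : ℤ) (t : List (Generator E)) (g : Generator E) :
    freeTrace K n t (FreeAssoc.of K g) = wordTrace K n (g :: t) := by
  simp [FreeAssoc.of, freeTrace_single, letters_of]

lemma freeTrace_of_mul_of (n : ℤ) (t : List (Generator E)) (g h : Generator E) :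
    freeTrace K n t (FreeAssoc.of K g * FreeAssoc.of K h) = wordTrace K n (g :: h :: t) := by
  simp [FreeAssoc.of, freeTrace_single, letters_of, letters_mul]

lemma freeTrace_mul_comm (n : ℤ) (a b : FreeAssoc K (Generator E)) :
    freeTrace K n [] (a * b) = freeTrace K n [] (b * a) := by
  induction a using MonoidAlgebra.induction_linear with
  | zero => simp
  | add a a' h h' => simp only [add_mul, mul_add, map_add, h, h']
  | single w k =>
    induction b using MonoidAlgebra.induction_linear with
    | zero => simp
    | add b b' h h' => simp only [add_mul, mul_add, map_add, h, h']
    | single w' k' =>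
      simp only [MonoidAlgebra.single_mul_single, freeTrace_single, letters_mul, List.append_nil]
      rw [wordTrace_append_comm, mul_comm k]

/-- The trace functionals respect the defining relations.  For (CK2) this is additivity of the
number of fixed points, which holds because a word of nonzero degree has at most one. -/
lemma freeTrace_rel {n : ℤ} (hn : n ≠ 0) {a b : FreeAssoc K (Generator E)} (h : Rel K E a b)
    (t : List (Generator E)) : freeTrace K n t a = freeTrace K n t b := by
  classical
  cases h with
  | CK2 a hne hfin =>
    simp only [map_sum, freeTrace_of_mul_of, freeTrace_of]
    have hrun : ∀ x y, Run (vertex a :: t) x y ↔ Run t x y ∧ E.s (y.1 0) = a := by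
      intro x y
      simp only [Run, Step]
      grind
    have hrun' : ∀ e x y, Run (edge e :: ghost e :: t) x y ↔ Run t x y ∧ y.1 0 = e := by
      intro e x y
      simp only [Run, Step]
      constructor
      · rintro ⟨z, ⟨z', h, h1, h2⟩, h3, h4⟩
        obtain rfl : y = z' := ext_tail (h3.trans h1.symm) (h4.trans h2.symm)
        exact ⟨h, h3⟩
      · rintro ⟨h, h1⟩
        exact ⟨y.tail, ⟨y, h, h1, rfl⟩, h1, rfl⟩
    have h1 := wordTrace_eq_ite (K := K) (n := n) (l := vertex a :: t)
      (p := wordDegree t = n ∧ ∃ x, Run t x x ∧ E.s (x.1 0) = a)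
      (by simp only [hrun, wordDegree_cons, Generator.degree, zero_add])
    have h2 := fun e => wordTrace_eq_ite (K := K) (n := n) (l := edge e :: ghost e :: t)
      (p := wordDegree t = n ∧ ∃ x, Run t x x ∧ x.1 0 = e)
      (by simp only [hrun', wordDegree_cons, Generator.degree, add_neg_cancel_left])
    simp only [h1, h2]
    by_cases hd : wordDegree t = n
    · by_cases hx : ∃ x, Run t x x
      · obtain ⟨x, hx⟩ := hx
        have huniq : ∀ y, Run t y y ↔ y = x := fun y =>
          ⟨fun hy => hy.eq_of_fixed (hd ▸ hn) hx, fun h => h ▸ hx⟩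
        simp [huniq, hd]
      · have hx' : ∀ x, ¬ Run t x x := fun x h => hx ⟨x, h⟩
        simp [hx']
    · simp [hd]
  | CK1_same e =>
    rw [freeTrace_of_mul_of, freeTrace_of]
    refine wordTrace_congr (by simp [Generator.degree]) fun x y => ?_
    simp only [Run, Step]
    constructor
    · rintro ⟨z, ⟨z', h, h1, rfl⟩, -, rfl⟩
      exact ⟨_, h, rfl, by rw [← z.r_zero, h1]⟩
    · rintro ⟨z, h, rfl, h1⟩
      exact ⟨z.cons e h1.symm, ⟨z, h, rfl, rfl⟩, rfl, rfl⟩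
  | _ =>
    simp only [map_zero, freeTrace_of_mul_of, freeTrace_of]
    first
    | apply wordTrace_congr
      · simp [Generator.degree]
      · intro x y
        simp only [Run, Step]
        grind [InfinitePath.r_zero]
    | apply wordTrace_eq_zero
      intro x y
      simp only [Run, Step]
      grind

lemma freeTrace_mul_right {n : ℤ} {a b : FreeAssoc K (Generator E)}
    (h : ∀ t, freeTrace K n t a = freeTrace K n t b) (c : FreeAssoc K (Generator E))
    (t : List (Generator E)) : freeTrace K n t (a * c) = freeTrace K n t (b * c) := by
  induction c using MonoidAlgebra.induction_linear with
  | zero => simp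
  | add c d hc hd => simp only [mul_add, map_add, hc, hd]
  | single w k =>
    have key : ∀ a : FreeAssoc K (Generator E), freeTrace K n t (a * MonoidAlgebra.single w k) =
        k * freeTrace K n (letters w ++ t) a := by
      intro a
      induction a using MonoidAlgebra.induction_linear with
      | zero => simp
      | add c d hc hd => simp only [add_mul, mul_add, map_add, hc, hd]
      | single u l =>
        simp only [MonoidAlgebra.single_mul_single, freeTrace_single, letters_mul,
          List.append_assoc]
        ring
    rw [key, key, h]

lemma freeTrace_mul_left {n : ℤ} {a b : FreeAssoc K (Generator E)}
    (h : ∀ t, freeTrace K n t a = freeTrace K n t b) (c : FreeAssoc K (Generator E))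
    (t : List (Generator E)) : freeTrace K n t (c * a) = freeTrace K n t (c * b) := by
  induction c using MonoidAlgebra.induction_linear with
  | zero => simp
  | add c d hc hd => simp only [add_mul, map_add, hc, hd]
  | single w k =>
    have key : ∀ a : FreeAssoc K (Generator E), freeTrace K n t (MonoidAlgebra.single w k * a) =
        k * freeTrace K n (t ++ letters w) a := by
      intro a
      induction a using MonoidAlgebra.induction_linear with
      | zero => simp
      | add c d hc hd => simp only [mul_add, map_add, hc, hd]
      | single u l =>
        simp only [MonoidAlgebra.single_mul_single, freeTrace_single, letters_mul,
          List.append_assoc]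
        rw [wordTrace_append_comm, List.append_assoc, mul_assoc]
    rw [key, key, h]

lemma freeTrace_con {n : ℤ} (hn : n ≠ 0) {a b : FreeAssoc K (Generator E)} (h : con K E a b)
    (t : List (Generator E)) : freeTrace K n t a = freeTrace K n t b := by
  induction h generalizing t with
  | of a b h =>
    obtain ⟨k, a', b', hr, rfl, rfl⟩ := h
    rw [map_smul, map_smul, freeTrace_rel hn hr]
  | refl a => rfl
  | symm _ ih => exact (ih t).symm
  | trans _ _ ih₁ ih₂ => exact (ih₁ t).trans (ih₂ t)
  | add _ _ ih₁ ih₂ => rw [map_add, map_add, ih₁, ih₂]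
  | mul _ _ ih₁ ih₂ => exact (freeTrace_mul_right ih₁ _ t).trans (freeTrace_mul_left ih₂ _ t)

/-- The degree `n` trace of `L_K(E)`, `n ≠ 0`: the trace of the degree `n` component of an element
in its action on the infinite paths. -/
def degreeTrace (K : Type u) [Field K] (E : DirectedGraph.{v, w}) {n : ℤ} (hn : n ≠ 0) :
    LeavittPathAlgebra K E →ₗ[K] K where
  toFun y := Quotient.liftOn' y (freeTrace K n []) fun _ _ h => freeTrace_con hn h []
  map_add' y z := by
    obtain ⟨a, rfl⟩ := mk_surjective y
    obtain ⟨b, rfl⟩ := mk_surjective z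
    exact map_add (freeTrace K n []) a b
  map_smul' k y := by
    obtain ⟨a, rfl⟩ := mk_surjective y
    exact map_smul (freeTrace K n []) k a

lemma degreeTrace_mk {n : ℤ} (hn : n ≠ 0) (a : FreeAssoc K (Generator E)) :
    degreeTrace K E hn (mk a) = freeTrace K n [] a := rfl

lemma degreeTrace_mul_comm {n : ℤ} (hn : n ≠ 0) (y z : LeavittPathAlgebra K E) :
    degreeTrace K E hn (y * z) = degreeTrace K E hn (z * y) := by
  obtain ⟨a, rfl⟩ := mk_surjective y
  obtain ⟨b, rfl⟩ := mk_surjective z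
  rw [← mk_mul, ← mk_mul, degreeTrace_mk, degreeTrace_mk, freeTrace_mul_comm]

/-- The element of `L_K(E)` given by a nonempty word in the generators. -/
def ofWord (K : Type u) [Field K] {E : DirectedGraph.{v, w}} (w : FreeSemigroup (Generator E)) :
    LeavittPathAlgebra K E := mk (MonoidAlgebra.single w 1)

lemma ofWord_mul (w z : FreeSemigroup (Generator E)) :
    ofWord K (w * z) = ofWord K w * ofWord K z := by
  simp only [ofWord, ← mk_mul, MonoidAlgebra.single_mul_single, mul_one]

lemma degreeTrace_ofWord {n : ℤ} (hn : n ≠ 0) (w : FreeSemigroup (Generator E)) :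
    degreeTrace K E hn (ofWord K w) = wordTrace K n (letters w) := by
  rw [ofWord, degreeTrace_mk, freeTrace_single, one_mul, List.append_nil]

/-- The standard involution maps words to words and changes the sign of the degree. -/
lemma exists_star_ofWord (w : FreeSemigroup (Generator E)) :
    ∃ z, star (ofWord K w) = ofWord K z ∧
      wordDegree (letters z) = -wordDegree (letters w) := by
  induction w using FreeSemigroup.recOnMul with
  | ih1 g =>
    refine ⟨.of g.conj, star_gen g, ?_⟩
    cases g <;> simp [letters_of, Generator.conj, Generator.degree, wordDegree]
  | ih2 a b ha hb =>
    obtain ⟨y, hy, hy'⟩ := ha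
    obtain ⟨z, hz, hz'⟩ := hb
    refine ⟨z * y, by rw [ofWord_mul, star_mul, hy, hz, ofWord_mul], ?_⟩
    rw [letters_mul, letters_mul, wordDegree_append, wordDegree_append, hy', hz']
    ring

/-- For a cycle `c` of length `n`, the skew element `c - c*` has degree `n` trace `1`, because `c`
fixes the infinite path `c c c ⋯` and `c*` has degree `-n`, whereas commutators have trace `0`. -/
lemma skewElements_ne_commutatorSpan (hE : E.HasCycle) :
    skewElements (LeavittPathAlgebra K E) ≠
      (commutatorSpan K (skewElements (LeavittPathAlgebra K E)) :
        Set (LeavittPathAlgebra K E)) := by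
  intro heq
  obtain ⟨c, hc⟩ := hE
  obtain ⟨x, hx, hper⟩ := hc.exists_infinitePath
  have hrun := run_edges c x hx
  rw [hper] at hrun
  obtain ⟨w, hw⟩ : ∃ w : FreeSemigroup (Generator E), letters w = c.map edge := by
    cases c with
    | nil => exact absurd rfl hc.1
    | cons e l => exact ⟨⟨edge e, l.map edge⟩, rfl⟩
  have hdeg : wordDegree (letters w) = c.length := by
    rw [hw]
    simp [wordDegree, Function.comp_def, Generator.degree]
  have hn : (c.length : ℤ) ≠ 0 := by
    simpa using hc.1
  obtain ⟨z, hz, hzdeg⟩ := exists_star_ofWord (K := K) w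
  have hskew : ofWord K w - star (ofWord K w) ∈ skewElements (LeavittPathAlgebra K E) := by
    simp [skewElements]
  have hker : commutatorSpan K (skewElements (LeavittPathAlgebra K E)) ≤
      LinearMap.ker (degreeTrace K E hn) := by
    refine Submodule.span_le.2 ?_
    rintro _ ⟨a, -, b, -, rfl⟩
    simp [degreeTrace_mul_comm hn a b]
  rw [heq] at hskew
  have h0 := hker hskew
  rw [LinearMap.mem_ker, map_sub, hz, degreeTrace_ofWord, degreeTrace_ofWord, wordTrace, wordTrace,
    if_pos ⟨hdeg, x, hw ▸ hrun⟩, if_neg (by rintro ⟨h, -⟩; omega)] at h0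
  simp at h0

end LeavittPathAlgebra

/-! ### Simplicity of the Leavitt algebras of roses -/

namespace LeavittPathAlgebra

open DirectedGraph Generator

variable {K : Type u} [Field K] {n : ℕ}

/-- The vertex of the rose, which is the unit element of its Leavitt path algebra. -/
def roseOne (K : Type u) [Field K] (n : ℕ) : LeavittPathAlgebra K (rose n) := gen K (vertex ())

lemma roseOne_mul (a : LeavittPathAlgebra K (rose n)) : roseOne K n * a = a := by
  have hgen : ∀ g : Generator (rose n), roseOne K n * gen K g = gen K g := by
    intro g
    cases g with
    | vertex a => exact mk_eq_of_rel (.V_same _)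
    | edge e => exact mk_eq_of_rel (.E1_left e)
    | ghost e => exact mk_eq_of_rel (.E2_left e)
  induction a using induction_gen with
  | gen g => exact hgen g
  | zero => simp
  | add a b ha hb => rw [mul_add, ha, hb]
  | smul k a ha => rw [mul_smul_comm, ha]
  | mul g b _ => rw [← mul_assoc, hgen]

lemma star_roseOne : star (roseOne K n) = roseOne K n := star_gen _

lemma mul_roseOne (a : LeavittPathAlgebra K (rose n)) : a * roseOne K n = a := by
  apply star_injective
  rw [star_mul, star_roseOne, roseOne_mul]

/-- The real path `e₁ ⋯ eₘ` in the Leavitt path algebra of a rose; the empty path is the unit. -/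
def rosePath (K : Type u) [Field K] {n : ℕ} (l : List (Fin n)) : LeavittPathAlgebra K (rose n) :=
  (l.map fun e => gen K (edge e)).foldr (· * ·) (roseOne K n)

@[simp] lemma rosePath_nil : rosePath K ([] : List (Fin n)) = roseOne K n := rfl

@[simp] lemma rosePath_cons (e : Fin n) (l : List (Fin n)) :
    rosePath K (e :: l) = gen K (edge e) * rosePath K l := rfl

lemma rosePath_append (l m : List (Fin n)) :
    rosePath K (l ++ m) = rosePath K l * rosePath K m := by
  induction l with
  | nil => simp [roseOne_mul]
  | cons e l ih => simp [ih, mul_assoc]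

lemma ghost_mul_rosePath_cons (e f : Fin n) (l : List (Fin n)) :
    gen K (ghost e) * rosePath K (f :: l) = if e = f then rosePath K l else 0 := by
  rw [rosePath_cons, ← mul_assoc]
  split_ifs with h
  · subst h
    have : gen K (ghost e) * gen K (edge e) = roseOne K n :=
      mk_eq_of_rel (.CK1_same (E := rose n) e)
    rw [this, roseOne_mul]
  · have : gen K (ghost e) * gen K (edge f) = (0 : LeavittPathAlgebra K (rose n)) :=
      mk_eq_of_rel (.CK1_ne (E := rose n) e f h)
    rw [this, zero_mul]

lemma star_rosePath_mul_self (l : List (Fin n)) :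
    star (rosePath K l) * rosePath K l = roseOne K n := by
  induction l with
  | nil => simp [star_roseOne, roseOne_mul]
  | cons e l ih =>
    rw [rosePath_cons, star_mul, star_gen, mul_assoc, ← rosePath_cons, Generator.conj,
      ghost_mul_rosePath_cons, if_pos rfl, ih]

lemma star_rosePath_mul_eq_zero {l m : List (Fin n)} (hlen : l.length ≤ m.length)
    (h : ¬ l <+: m) : star (rosePath K l) * rosePath K m = 0 := by
  induction l generalizing m with
  | nil => exact absurd List.nil_prefix h
  | cons e l ih =>
    cases m with
    | nil => simp at hlen
    | cons f m =>
      rw [rosePath_cons, star_mul, star_gen, mul_assoc, Generator.conj, ghost_mul_rosePath_cons]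
      split_ifs with hef
      · subst hef
        exact ih (by simpa using hlen) fun hp => h (by simpa using hp)
      · rw [mul_zero]

/-- Multiplication by sufficiently long real paths on the right turns every element into a linear
combination of real paths. -/
lemma exists_mul_rosePath_mem_span (a : LeavittPathAlgebra K (rose n)) :
    ∃ N, ∀ q : List (Fin n), N ≤ q.length →
      a * rosePath K q ∈ Submodule.span K
        (rosePath K '' {l : List (Fin n) | q.length ≤ l.length + N}) := by
  have hgen : ∀ g : Generator (rose n), ∀ (N M : ℕ), N + 1 ≤ M →
      ∀ b ∈ Submodule.span K (rosePath K '' {l : List (Fin n) | M ≤ l.length + N}),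
        gen K g * b ∈ Submodule.span K
          (rosePath K '' {l : List (Fin n) | M ≤ l.length + (N + 1)}) := by
    intro g N M hM b hb
    induction hb using Submodule.span_induction with
    | zero => simp
    | add b c _ _ hb hc => rw [mul_add]; exact add_mem hb hc
    | smul k b _ hb => rw [mul_smul_comm]; exact Submodule.smul_mem _ _ hb
    | mem b hb =>
      obtain ⟨l, hl, rfl⟩ := hb
      simp only [Set.mem_ofPred_eq] at hl
      cases g with
      | vertex a =>
        have : gen K (vertex a) * rosePath K l = rosePath K l := roseOne_mul _
        rw [this]
        exact Submodule.subset_span ⟨l, by simp only [Set.mem_ofPred_eq]; omega, rfl⟩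
      | edge e =>
        exact Submodule.subset_span
          ⟨e :: l, by simp only [Set.mem_ofPred_eq, List.length_cons]; omega, rfl⟩
      | ghost e =>
        cases l with
        | nil => simp at hl; omega
        | cons f l =>
          rw [ghost_mul_rosePath_cons]
          split_ifs
          · simp only [List.length_cons] at hl
            exact Submodule.subset_span ⟨l, by simp only [Set.mem_ofPred_eq]; omega, rfl⟩
          · exact zero_mem _
  have hmono : ∀ {N N' M : ℕ}, N ≤ N' →
      Submodule.span K (rosePath K '' {l : List (Fin n) | M ≤ l.length + N}) ≤
      Submodule.span K (rosePath K '' {l : List (Fin n) | M ≤ l.length + N'}) := by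
    intro N N' M h
    refine Submodule.span_mono (Set.image_mono fun l hl => ?_)
    simp only [Set.mem_ofPred_eq] at hl ⊢
    omega
  induction a using induction_gen with
  | gen g =>
    exact ⟨1, fun q hq => hgen g 0 q.length hq _ (Submodule.subset_span ⟨q, by simp, rfl⟩)⟩
  | zero => exact ⟨0, fun q _ => by simp⟩
  | add a b ha hb =>
    obtain ⟨N, hN⟩ := ha
    obtain ⟨M, hM⟩ := hb
    refine ⟨max N M, fun q hq => ?_⟩
    rw [add_mul]
    exact add_mem (hmono (le_max_left _ _) (hN q (by omega)))
      (hmono (le_max_right _ _) (hM q (by omega)))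
  | smul k a ha =>
    obtain ⟨N, hN⟩ := ha
    exact ⟨N, fun q hq => by rw [smul_mul_assoc]; exact Submodule.smul_mem _ _ (hN q hq)⟩
  | mul g b hb =>
    obtain ⟨N, hN⟩ := hb
    refine ⟨N + 1, fun q hq => ?_⟩
    rw [mul_assoc]
    exact hgen g N q.length hq _ (hN q (by omega))

/-- By (CK2), right multiplication by all real paths of a given length is jointly injective. -/
lemma exists_mul_rosePath_ne_zero [NeZero n] {a : LeavittPathAlgebra K (rose n)} (ha : a ≠ 0)
    (N : ℕ) : ∃ q : List (Fin n), q.length = N ∧ a * rosePath K q ≠ 0 := by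
  induction N with
  | zero => exact ⟨[], rfl, by simpa [mul_roseOne] using ha⟩
  | succ N ih =>
    obtain ⟨q, rfl, hq⟩ := ih
    by_contra! h
    have hfin : {e | (rose n).s e = ()}.Finite := Set.toFinite _
    have hCK : roseOne K n = ∑ e ∈ hfin.toFinset, gen K (edge e) * gen K (ghost e) :=
      (mk_eq_of_rel (.CK2 (E := rose n) () ⟨(0 : Fin n), rfl⟩ hfin)).trans
        (map_sum (mkHom (K := K) (E := rose n)) _ _)
    apply hq
    rw [← mul_roseOne (a * rosePath K q), hCK, Finset.mul_sum]
    refine Finset.sum_eq_zero fun e _ => ?_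
    have := h (q ++ [e]) (by simp)
    rw [rosePath_append, rosePath_cons, rosePath_nil, mul_roseOne, ← mul_assoc] at this
    rw [← mul_assoc, this, zero_mul]

/-- Let `s = e ⋯ e f` with `f ≠ e` and with at least `|l|` copies of `e`. If `|l₀| ≤ |l|`, then
`l₀ s` is an initial part of `l s` only for `l = l₀`: otherwise `l = l₀ r` with `r` nonempty and `s`
is an initial part of `r s`, but the letter of `r s` at the position of `f` is an `e`. -/
lemma append_replicate_prefix {α : Type*} {e f : α} (hef : e ≠ f) {l₀ l : List α} {M : ℕ}
    (hlen : l₀.length ≤ l.length) (hM : l.length ≤ M)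
    (h : l₀ ++ (List.replicate M e ++ [f]) <+: l ++ (List.replicate M e ++ [f])) : l₀ = l := by
  have h1 : l₀ <+: l := List.prefix_of_prefix_length_le
    ((List.prefix_append _ _).trans h) (List.prefix_append _ _) hlen
  obtain ⟨r, rfl⟩ := h1
  rw [List.append_assoc, List.prefix_append_right_inj] at h
  have h2 := h.getElem (i := M) (by simp)
  rcases r with _ | ⟨b, r⟩
  · simp
  · exfalso
    simp at hM
    rw [List.getElem_append_right (by simp), List.getElem_append_right (by simp; omega),
      List.getElem_append_left (by simp; omega)] at h2
    simp at h2
    exact hef h2.symm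

/-- Every nonzero element of the Leavitt algebra `L_K(R_n)`, `n ≥ 2`, can be brought to the unit by
multiplying from both sides. -/
lemma exists_mul_mul_eq_roseOne (hn : 2 ≤ n) {a : LeavittPathAlgebra K (rose n)} (ha : a ≠ 0) :
    ∃ b c, b * a * c = roseOne K n := by
  have : NeZero n := ⟨by omega⟩
  obtain ⟨N, hN⟩ := exists_mul_rosePath_mem_span a
  obtain ⟨q, rfl, hq⟩ := exists_mul_rosePath_ne_zero ha N
  obtain ⟨k, hk⟩ := Finsupp.mem_span_range_iff_exists_finsupp.1
    (Submodule.span_mono (Set.image_subset_range _ _) (hN q le_rfl))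
  have hk0 : k.support.Nonempty := by
    rw [Finsupp.support_nonempty_iff]
    rintro rfl
    exact hq (by simpa using hk.symm)
  -- With `l₀` of minimal length in `a q = ∑ k l • l`, the path `s` separates `l₀ s` from all `l s`.
  obtain ⟨l₀, hl₀, hmin⟩ := k.support.exists_min_image List.length hk0
  obtain ⟨M, hM⟩ : ∃ M, ∀ l ∈ k.support, l.length ≤ M :=
    ⟨k.support.sup List.length, fun l hl => Finset.le_sup hl⟩
  have hef : (⟨0, by omega⟩ : Fin n) ≠ ⟨1, by omega⟩ := by simp
  set s : List (Fin n) := List.replicate M ⟨0, by omega⟩ ++ [⟨1, by omega⟩] with hs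
  have key : star (rosePath K (l₀ ++ s)) * (a * rosePath K q) * rosePath K s =
      k l₀ • roseOne K n := by
    rw [← hk, Finsupp.sum, Finset.mul_sum, Finset.sum_mul, Finset.sum_eq_single_of_mem l₀ hl₀]
    · rw [mul_smul_comm, smul_mul_assoc, mul_assoc, ← rosePath_append, star_rosePath_mul_self]
    · intro l hl hne
      rw [mul_smul_comm, smul_mul_assoc, mul_assoc, ← rosePath_append,
        star_rosePath_mul_eq_zero (by simpa using hmin l hl), smul_zero]
      exact fun h => hne (append_replicate_prefix hef (hmin l hl) (hM l hl) h).symm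
  refine ⟨(k l₀)⁻¹ • star (rosePath K (l₀ ++ s)), rosePath K q * rosePath K s, ?_⟩
  rw [← mul_assoc, mul_assoc _ a, smul_mul_assoc, smul_mul_assoc, key,
    inv_smul_smul₀ (Finsupp.mem_support_iff.1 hl₀)]

lemma rose_hasCycle (hn : 0 < n) : (rose n).HasCycle :=
  ⟨[(⟨0, hn⟩ : Fin n)], by simp, by simp, rfl, by simp⟩

lemma roseOne_ne_zero (hn : 0 < n) : roseOne K n ≠ 0 := by
  classical
  obtain ⟨c, hc⟩ := rose_hasCycle hn
  obtain ⟨x, -⟩ := hc.exists_infinitePath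
  intro h
  have h1 := congrArg (fun a => pathRep K (rose n) a (Finsupp.single x 1)) h
  simp [roseOne, genAct_vertex] at h1

lemma isSimple_rose (hn : 2 ≤ n) : IsSimpleNonUnitalRing (LeavittPathAlgebra K (rose n)) := by
  have h1 : roseOne K n ≠ 0 := roseOne_ne_zero (by omega)
  refine ⟨⟨roseOne K n, roseOne K n, by rwa [roseOne_mul]⟩, ⟨?_⟩⟩
  have hnt : Nontrivial (LeavittPathAlgebra K (rose n)) := ⟨_, _, h1⟩
  refine { exists_pair_ne := ⟨⊥, ⊤, bot_ne_top⟩, eq_bot_or_eq_top := fun I => ?_ }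
  refine or_iff_not_imp_left.2 fun hI => ?_
  obtain ⟨a, haI, ha⟩ : ∃ a ∈ I, a ≠ 0 := by
    by_contra! h
    exact hI (le_bot_iff.1 fun a ha => (TwoSidedIdeal.mem_bot _).2 (h a ha))
  obtain ⟨b, c, hbc⟩ := exists_mul_mul_eq_roseOne hn ha
  refine top_le_iff.1 fun y _ => ?_
  rw [← roseOne_mul y, ← hbc]
  exact I.mul_mem_right _ _ (I.mul_mem_right _ _ (I.mul_mem_left _ _ haI))

end LeavittPathAlgebra

end

theorem proposition3p9 (K : Type u) [Field K] :
    -- simple Leavitt path algebras over graphs containing a cycle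
    (∀ E : DirectedGraph.{v, w},
      IsSimpleNonUnitalRing (LeavittPathAlgebra K E) → E.HasCycle →
        IsFirstKind (LeavittPathAlgebra K E) ∧
        skewElements (LeavittPathAlgebra K E) ≠
          (commutatorSpan K (skewElements (LeavittPathAlgebra K E)) :
            Set (LeavittPathAlgebra K E))) ∧
    -- the roses with at least two petals
    (∀ n : ℕ, 2 ≤ n →
      IsSimpleNonUnitalRing (LeavittPathAlgebra K (DirectedGraph.rose n)) ∧
      IsFirstKind (LeavittPathAlgebra K (DirectedGraph.rose n)) ∧
      skewElements (LeavittPathAlgebra K (DirectedGraph.rose n)) ≠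
        (commutatorSpan K (skewElements (LeavittPathAlgebra K (DirectedGraph.rose n))) :
          Set (LeavittPathAlgebra K (DirectedGraph.rose n)))) ∧
    -- the negative answer to the general question
    ¬ (∀ (A : Type u) [NonUnitalRing A] [Module K A] [IsScalarTower K A A] [SMulCommClass K A A]
        [StarRing A], (∀ (k : K) (a : A), star (k • a) = k • star a) →
        IsSimpleNonUnitalRing A → IsFirstKind A →
        skewElements A = (commutatorSpan K (skewElements A) : Set A)) := by
  have rose_firstKind : ∀ n : ℕ, 2 ≤ n →
      IsFirstKind (LeavittPathAlgebra K (DirectedGraph.rose n)) := by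
    intro n hn
    obtain ⟨c, hc⟩ := LeavittPathAlgebra.rose_hasCycle (n := n) (by omega)
    obtain ⟨x, -⟩ := hc.exists_infinitePath
    exact LeavittPathAlgebra.isFirstKind (LeavittPathAlgebra.isSimple_rose hn).2 x
  refine ⟨fun E hs hE => ⟨?_, LeavittPathAlgebra.skewElements_ne_commutatorSpan hE⟩,
    fun n hn => ⟨LeavittPathAlgebra.isSimple_rose hn, rose_firstKind n hn,
      LeavittPathAlgebra.skewElements_ne_commutatorSpan
        (LeavittPathAlgebra.rose_hasCycle (by omega))⟩, fun h => ?_⟩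
  · obtain ⟨c, hc⟩ := hE
    obtain ⟨x, -⟩ := hc.exists_infinitePath
    exact LeavittPathAlgebra.isFirstKind hs.2 x
  · exact LeavittPathAlgebra.skewElements_ne_commutatorSpan
      (LeavittPathAlgebra.rose_hasCycle two_pos)
      (h (LeavittPathAlgebra K (DirectedGraph.rose 2)) LeavittPathAlgebra.star_smul_smul
        (LeavittPathAlgebra.isSimple_rose le_rfl) (rose_firstKind 2 le_rfl))
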